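/- There is an absolute constant $c>0$ such that the following holds. Let $n\in\mathbf N$, let $X, X_1,\dots,X_n$ be independent identically distributed real random variables, let $a=(a_1,\dots,a_n)\in\mathbf R^n$ with $\|a\|=1$, and let $L,D>0$ be real numbers. Here $\|x\|=(x_1^2+\dots+x_n^2)^{1/2}$ and $\|x\|_\infty=\max_j|x_j|$ for $x\in\mathbf R^n$. For $t>0$ put $$f_L(t)=\begin{cases} t/6, & 0<t<eL,\\ L\sqrt{\log(t/L)}, & t\ge eL.\end{cases}$$ Let $F_a$ be the distribution of $S_a=\sum_{k=1}^n a_kX_k$, and for a probability distribution $F$ on $\mathbf R$ and $\lambda>0$ let $Q(F,\lambda)=\sup_{x\in\mathbf R}F\{[x,x+\lambda]\}$ be its Lévy concentration function. Let $\widetilde X$ be the symmetrization of $X$, i.e. the difference of two independent copies of $X$, and put $M(\tau)=\mathbf E\min\{\widetilde X^2/\tau^2,1\}$ for $\tau>0$. Assume that $$\|ta-m\|\ge f_L(t)\quad\text{for all } m\in\mathbf Z^n \text{ and all } t\in\Big[\frac1{2\|a\|_\infty},D\Big],$$ and that $M(1)>0$ and $L^2\ge 1/M(1)$. Then $$Q\Big(F_a,\frac1D\Big)\le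 \frac{c}{D\sqrt{M(1)}}.$$ -/

import Mathlib

open MeasureTheory ProbabilityTheory

namespace LittlewoodOfford

noncomputable section

/-- The Lévy concentration function `Q(F, r) = sup_x F([x, x + r])` of a distribution `F` on `ℝ`. -/
def concentration (F : Measure ℝ) (r : ℝ) : ℝ :=
  ⨆ x : ℝ, F.real (Set.Icc x (x + r))

/-- The symmetrized distribution `G` of `F`: the law of `Y₁ - Y₂` where `Y₁, Y₂` are independent
with law `F`. -/
def symmetrization (F : Measure ℝ) : Measure ℝ :=
  (F.prod F).map (fun p : ℝ × ℝ => p.1 - p.2)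

/-- `M(τ) = E min {(Y₁ - Y₂)² / τ², 1}` for `Y₁, Y₂` independent with law `F`. -/
def truncatedMoment (F : Measure ℝ) (τ : ℝ) : ℝ :=
  ∫ x, min (x ^ 2 / τ ^ 2) 1 ∂(symmetrization F)

/-- The function `f_L(t)`, used for `L > 0` and `t > 0`. -/
def fL (L t : ℝ) : ℝ :=
  if t < Real.exp 1 * L then t / 6 else L * Real.sqrt (Real.log (t / L))

/-- The norm `‖a‖_∞ = max_k |a_k|` of a vector of the Euclidean space. -/
def supNorm {n : ℕ} (a : EuclideanSpace ℝ (Fin n)) : ℝ :=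
  ‖(WithLp.ofLp a : Fin n → ℝ)‖

/-- An integer vector, as a point of the Euclidean space. -/
def intVec {n : ℕ} (m : Fin n → ℤ) : EuclideanSpace ℝ (Fin n) :=
  WithLp.toLp 2 (fun k => (m k : ℝ))

end

end LittlewoodOfford

/-!
The proof is Fourier analytic. Esseen's inequality (`measureReal_Icc_le_integral_charFun`) bounds
the concentration function at `1 / D` by `(2 / D) ∫_{-D}^D |φ|`, where `φ` is the characteristic
function of the weighted sum. With `ψ(s) = ∑ₖ (1 - cos (s aₖ))` and `G` the law of the
symmetrization, `|φ(t)| ≤ exp (-½ ∫ ψ(t z) G(dz))` (`norm_charFun_sum_le`). The measure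
`min (z², 1) G(dz) / M`, with `M = M(1)`, is a probability, so Jensen's inequality and Fubini's
theorem (`integral_exp_neg_integral_cosDefect_le`) reduce the claim to the estimate
`∫_{-D}^D exp (-M ψ(t z) / (2 min (z², 1))) dt ≤ C / √M`, uniformly in `z ≠ 0`
(`integral_exp_neg_cosDefect_le`).

* For `0 < z ≤ 1`, the inequality `1 - cos (2 π x) ≥ 8 dist(x, ℤ)²` bounds `ψ(2 π u)` from below by
  eight times the squared distance from `u a` to the integer lattice, hence by `8 f_L(u)²` for
  `u ≤ D`. As `M L² ≥ 1`, both branches of `f_L` make the integrand at most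
  `36 / (1 + M t² / π²)` (`exp_neg_cosDefect_le`), whose integral is of order `1 / √M`.
* For `z ≥ 1`, the substitution `s = t z` leads out of the range where the lattice condition holds.
  But `exp (-M ψ / 2)` is a limit of cosine polynomials with nonnegative coefficients, so, the Fejér
  kernel being nonnegative, its integral over any interval of length `D` is at most twice its
  integral over `[-D, D]` (`IsCosSum.integral_exp_window_le`). Covering `[0, D z]` by `⌈z⌉` such
  intervals reduces the estimate to the case `z = 1`.
-/

namespace LittlewoodOfford

open Filter Topology

/-! ### The Fejér kernel -/

lemma intervalIntegral_integral_swap_of_bounded {μ : Measure ℝ} [IsFiniteMeasure μ]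
    {f : ℝ → ℝ → ℝ} (hf : Measurable (Function.uncurry f)) {a b : ℝ} (hab : a ≤ b) {C : ℝ}
    (hC : ∀ t ∈ Set.Icc a b, ∀ x, |f t x| ≤ C) :
    ∫ t in a..b, ∫ x, f t x ∂μ = ∫ x, (∫ t in a..b, f t x) ∂μ := by
  refine intervalIntegral_integral_swap ?_
  rw [Set.uIoc_of_le hab]
  have h1 : ∀ᵐ p : ℝ × ℝ ∂((volume.restrict (Set.Ioc a b)).prod μ), p.1 ∈ Set.Ioc a b :=
    Measure.quasiMeasurePreserving_fst.ae (ae_restrict_mem measurableSet_Ioc)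
  refine Integrable.mono' (integrable_const C) hf.aestronglyMeasurable ?_
  filter_upwards [h1] with p hp
  exact hC p.1 (Set.Ioc_subset_Icc_self hp) p.2

/-- The Fejér kernel `∫_{-T}^T (1 - |s| / T) cos (s u) ds`, that is, the Fourier transform of the
triangular weight on `[-T, T]`. -/
noncomputable def fejer (T u : ℝ) : ℝ := ∫ s in (-T)..T, (1 - |s| / T) * Real.cos (s * u)

lemma triangle_nonneg {T s : ℝ} (hs : s ∈ Set.Icc (-T) T) : 0 ≤ 1 - |s| / T := by
  have h : |s| ≤ T := abs_le.2 hs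
  have := div_le_one_of_le₀ h ((abs_nonneg s).trans h)
  linarith

lemma triangle_le_one {T : ℝ} (hT : 0 < T) (s : ℝ) : 1 - |s| / T ≤ 1 := by
  have : 0 ≤ |s| / T := by positivity
  linarith

lemma abs_triangle_le_one {T s : ℝ} (hT : 0 < T) (hs : s ∈ Set.Icc (-T) T) :
    |1 - |s| / T| ≤ 1 := by
  rw [abs_of_nonneg (triangle_nonneg hs)]
  exact triangle_le_one hT s

lemma integral_neg_self_eq_two_mul {f : ℝ → ℝ} (hf : Continuous f) (heven : ∀ s, f (-s) = f s)
    (T : ℝ) : ∫ s in (-T)..T, f s = 2 * ∫ s in (0 : ℝ)..T, f s := by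
  rw [← intervalIntegral.integral_add_adjacent_intervals (b := 0)
    (hf.intervalIntegrable _ _) (hf.intervalIntegrable _ _)]
  have h := intervalIntegral.integral_comp_neg (a := 0) (b := T) f
  simp only [heven, neg_zero] at h
  rw [← h]; ring

lemma integral_neg_self_eq_zero {f : ℝ → ℝ} (hodd : ∀ s, f (-s) = -f s) (T : ℝ) :
    ∫ s in (-T)..T, f s = 0 := by
  have h := intervalIntegral.integral_comp_neg (a := -T) (b := T) f
  simp only [hodd, intervalIntegral.integral_neg, neg_neg] at h
  linarith

lemma integral_triangle {T : ℝ} (hT : 0 < T) : ∫ s in (-T)..T, (1 - |s| / T) = T := by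
  rw [integral_neg_self_eq_two_mul (by fun_prop) (by simp)]
  have h : ∫ s in (0 : ℝ)..T, (1 - |s| / T) = ∫ s in (0 : ℝ)..T, (1 - s / T) := by
    refine intervalIntegral.integral_congr fun s hs => ?_
    rw [Set.uIcc_of_le hT.le] at hs
    simp only [abs_of_nonneg hs.1]
  rw [h, intervalIntegral.integral_sub (by simp) (by apply Continuous.intervalIntegrable; fun_prop)]
  simp only [intervalIntegral.integral_const, intervalIntegral.integral_div, integral_id]
  simp only [smul_eq_mul]
  field_simp
  ring

/-- Integrating by parts, the Fejér kernel equals `2 (1 - cos (T u)) / (T u ^ 2)` for `u ≠ 0`. -/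
lemma fejer_nonneg {T : ℝ} (hT : 0 < T) (u : ℝ) : 0 ≤ fejer T u := by
  unfold fejer
  rcases eq_or_ne u 0 with rfl | hu
  · simpa using (integral_triangle hT).symm ▸ hT.le
  rw [integral_neg_self_eq_two_mul (by fun_prop) (by simp)]
  have h : ∫ s in (0 : ℝ)..T, (1 - |s| / T) * Real.cos (s * u)
      = ∫ s in (0 : ℝ)..T, (1 - s / T) * Real.cos (s * u) := by
    refine intervalIntegral.integral_congr fun s hs => ?_
    rw [Set.uIcc_of_le hT.le] at hs
    simp only [abs_of_nonneg hs.1]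
  have hd : ∀ s ∈ Set.uIcc 0 T, HasDerivAt
      (fun s => (1 - s / T) * (Real.sin (s * u) / u) - Real.cos (s * u) / (T * u ^ 2))
      ((1 - s / T) * Real.cos (s * u)) s := by
    intro s _
    have hl : HasDerivAt (fun s : ℝ => s * u) u s := by
      simpa using (hasDerivAt_id s).mul_const u
    have h1 : HasDerivAt (fun s : ℝ => 1 - s / T) (-(1 / T)) s := by
      simpa using ((hasDerivAt_id s).div_const T).const_sub 1
    refine ((h1.mul (hl.sin.div_const u)).sub (hl.cos.div_const (T * u ^ 2))).congr_deriv ?_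
    field_simp
    ring
  rw [h, intervalIntegral.integral_eq_sub_of_hasDerivAt hd
    (by apply Continuous.intervalIntegrable; fun_prop)]
  have hc := Real.cos_le_one (T * u)
  have : 0 ≤ (1 - Real.cos (T * u)) / (T * u ^ 2) := div_nonneg (by linarith) (by positivity)
  simp only [div_self hT.ne', zero_mul, Real.sin_zero, Real.cos_zero, sub_div] at this ⊢
  norm_num
  simpa using this

lemma half_le_fejer {T u : ℝ} (hT : 0 < T) (hu : |T * u| ≤ 1 / 2) : T / 2 ≤ fejer T u := by
  have h : ∫ s in (-T)..T, (1 - |s| / T) * (1 / 2) ≤ fejer T u := by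
    refine intervalIntegral.integral_mono_on (by linarith)
      (by apply Continuous.intervalIntegrable; fun_prop)
      (by apply Continuous.intervalIntegrable; fun_prop) fun s hs => ?_
    refine mul_le_mul_of_nonneg_left ?_ (triangle_nonneg hs)
    have h1 : |s * u| ≤ 1 / 2 := by
      refine le_trans ?_ hu
      rw [abs_mul, abs_mul, abs_of_pos hT]
      exact mul_le_mul_of_nonneg_right (abs_le.2 hs) (abs_nonneg u)
    have h2 := Real.one_sub_sq_div_two_le_cos (x := s * u)
    have h3 := sq_le_sq.2 (h1.trans (le_abs_self (1 / 2)))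
    linarith
  rw [intervalIntegral.integral_mul_const, integral_triangle hT] at h
  linarith

/-! ### Esseen's inequality -/

lemma integral_cos_le_norm_charFun (μ : Measure ℝ) [IsFiniteMeasure μ] (t y : ℝ) :
    ∫ x, Real.cos (t * (x - y)) ∂μ ≤ ‖charFun μ t‖ := by
  have hint : Integrable (fun x : ℝ => Complex.exp (t * (x - y) * Complex.I)) μ := by
    refine Integrable.mono' (integrable_const 1) (by fun_prop) (ae_of_all _ fun x => ?_)
    rw [← Complex.ofReal_sub, ← Complex.ofReal_mul, Complex.norm_exp_ofReal_mul_I]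
  have h1 : ∫ x : ℝ, Complex.exp (t * (x - y) * Complex.I) ∂μ
      = Complex.exp ((-(t * y) : ℝ) * Complex.I) * charFun μ t := by
    rw [charFun_apply_real, ← integral_const_mul]
    refine integral_congr_ae (ae_of_all _ fun x => ?_)
    simp only [← Complex.exp_add]
    push_cast
    ring_nf
  have h2 : ∫ x, Real.cos (t * (x - y)) ∂μ
      = (∫ x : ℝ, Complex.exp (t * (x - y) * Complex.I) ∂μ).re := by
    have := integral_re hint
    simp only [RCLike.re_to_complex] at this
    rw [← this]
    refine integral_congr_ae (ae_of_all _ fun x => ?_)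
    simp only [← Complex.ofReal_sub, ← Complex.ofReal_mul, Complex.exp_ofReal_mul_I_re]
  rw [h2, h1]
  refine (Complex.re_le_norm _).trans ?_
  rw [norm_mul, Complex.norm_exp_ofReal_mul_I, one_mul]

/-- Esseen's inequality: integrating the Fejér kernel centred at the midpoint of `[x, x + 1 / D]`
against `μ` bounds `μ [x, x + 1 / D]` from above. -/
lemma measureReal_Icc_le_integral_charFun (μ : Measure ℝ) [IsProbabilityMeasure μ] {D : ℝ}
    (hD : 0 < D) (x : ℝ) :
    μ.real (Set.Icc x (x + 1 / D)) ≤ 2 / D * ∫ t in (-D)..D, ‖charFun μ t‖ := by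
  set y := x + 1 / (2 * D) with hy
  set f : ℝ → ℝ → ℝ := fun t u => (1 - |t| / D) * Real.cos (t * (u - y)) with hf
  have hfm : Measurable (Function.uncurry f) := by
    refine Continuous.measurable ?_
    simp only [hf, Function.uncurry_def]
    fun_prop
  have hfb : ∀ t ∈ Set.Icc (-D) D, ∀ u, |f t u| ≤ 1 := fun t ht u => by
    simp only [hf, abs_mul]
    exact mul_le_one₀ (abs_triangle_le_one hD ht) (abs_nonneg _) (Real.abs_cos_le_one _)
  have hDD : -D ≤ D := by linarith
  have hswap := intervalIntegral_integral_swap_of_bounded (μ := μ) hfm hDD hfb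
  have hcont : Continuous (fun t => ‖charFun μ t‖) := by
    have := (continuous_charFun (μ := μ))
    fun_prop
  have hle : ∫ t in (-D)..D, ∫ u, f t u ∂μ ≤ ∫ t in (-D)..D, ‖charFun μ t‖ := by
    have hfc : Continuous fun t => ∫ u, f t u ∂μ := by
      simp only [hf, integral_const_mul]
      refine Continuous.mul (by fun_prop) ?_
      refine continuous_of_dominated (bound := fun _ => 1) (fun t => by fun_prop)
        (fun t => ae_of_all _ fun u => Real.abs_cos_le_one _) (integrable_const 1)
        (ae_of_all _ fun u => by fun_prop)
    refine intervalIntegral.integral_mono_on hDD (hfc.intervalIntegrable _ _)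
      (hcont.intervalIntegrable _ _) fun t ht => ?_
    simp only [hf, integral_const_mul]
    refine (mul_le_mul_of_nonneg_left (integral_cos_le_norm_charFun μ t y)
      (triangle_nonneg ht)).trans ?_
    exact mul_le_of_le_one_left (norm_nonneg _) (triangle_le_one hD t)
  have hge : D / 2 * μ.real (Set.Icc x (x + 1 / D)) ≤ ∫ u, fejer D (u - y) ∂μ := by
    have hb : ∀ u, |fejer D u| ≤ 1 * |D - -D| := fun u => by
      refine intervalIntegral.norm_integral_le_of_norm_le_const (E := ℝ) fun t ht => ?_
      rw [Set.uIoc_of_le hDD] at ht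
      rw [norm_mul]
      exact mul_le_one₀ (abs_triangle_le_one hD (Set.Ioc_subset_Icc_self ht)) (norm_nonneg _)
        (Real.abs_cos_le_one _)
    have hcF : Continuous fun u => fejer D (u - y) := by
      unfold fejer
      refine intervalIntegral.continuous_parametric_intervalIntegral_of_continuous' ?_ _ _
      simp only [Function.uncurry_def]
      fun_prop
    have hint : Integrable (fun u => fejer D (u - y)) μ :=
      Integrable.mono' (integrable_const _) hcF.aestronglyMeasurable (ae_of_all _ fun u => hb _)
    have : ∫ u, (Set.Icc x (x + 1 / D)).indicator (fun _ => D / 2) u ∂μ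
        = D / 2 * μ.real (Set.Icc x (x + 1 / D)) := by
      rw [integral_indicator_const _ measurableSet_Icc, smul_eq_mul, mul_comm]
    rw [← this]
    refine integral_mono ((integrable_const _).indicator measurableSet_Icc) hint fun u => ?_
    by_cases hu : u ∈ Set.Icc x (x + 1 / D)
    · simp only [Set.indicator_of_mem hu]
      refine half_le_fejer hD ?_
      have e : D * (u - y) = D * (u - x) - 1 / 2 := by rw [hy]; field_simp; ring
      have h1 : 0 ≤ D * (u - x) := mul_nonneg hD.le (by linarith [hu.1])
      have h2 : D * (u - x) ≤ D * (1 / D) := mul_le_mul_of_nonneg_left (by linarith [hu.2]) hD.le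
      rw [mul_one_div_cancel hD.ne'] at h2
      rw [e, abs_le]
      constructor <;> linarith
    · simp only [Set.indicator_of_notMem hu]
      exact fejer_nonneg hD _
  rw [hswap] at hle
  have h := hge.trans hle
  calc μ.real (Set.Icc x (x + 1 / D))
      = 2 / D * (D / 2 * μ.real (Set.Icc x (x + 1 / D))) := by field_simp
    _ ≤ _ := mul_le_mul_of_nonneg_left h (by positivity)

/-! ### Trigonometric polynomials with nonnegative coefficients -/

/-- The convex cone generated by the functions `s ↦ cos (b s)`, `b ∈ ℝ`. -/
inductive IsCosSum : (ℝ → ℝ) → Prop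
  | cos (b : ℝ) : IsCosSum fun s => Real.cos (s * b)
  | smul {f : ℝ → ℝ} {c : ℝ} (hc : 0 ≤ c) (hf : IsCosSum f) : IsCosSum fun s => c * f s
  | add {f g : ℝ → ℝ} (hf : IsCosSum f) (hg : IsCosSum g) : IsCosSum fun s => f s + g s

namespace IsCosSum

lemma const {c : ℝ} (hc : 0 ≤ c) : IsCosSum fun _ => c := by
  simpa using (cos 0).smul hc

lemma continuous {f : ℝ → ℝ} (hf : IsCosSum f) : Continuous f := by
  induction hf with
  | cos b => fun_prop
  | smul _ _ ih => fun_prop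
  | add _ _ ih1 ih2 => fun_prop

lemma sum {ι : Type*} (s : Finset ι) {f : ι → ℝ → ℝ} (hf : ∀ i ∈ s, IsCosSum (f i)) :
    IsCosSum fun x => ∑ i ∈ s, f i x := by
  classical
  induction s using Finset.induction_on with
  | empty => simpa using const le_rfl
  | insert a s ha ih =>
    simp only [Finset.sum_insert ha]
    exact (hf _ (Finset.mem_insert_self _ _)).add
      (ih fun i hi => hf _ (Finset.mem_insert_of_mem hi))

lemma mul {f g : ℝ → ℝ} (hf : IsCosSum f) (hg : IsCosSum g) : IsCosSum fun s => f s * g s := by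
  induction hf with
  | cos b =>
    induction hg with
    | cos d =>
      convert ((cos (b - d)).add (cos (b + d))).smul (c := 1 / 2) (by norm_num) using 2 with s
      simp only [mul_sub, mul_add, Real.cos_sub, Real.cos_add]
      ring
    | smul hc _ ih =>
      convert ih.smul hc using 2
      ring
    | add _ _ ih1 ih2 =>
      convert ih1.add ih2 using 2
      ring
  | smul hc _ ih =>
    convert ih.smul hc using 2
    ring
  | add _ _ ih1 ih2 =>
    convert ih1.add ih2 using 2
    ring

lemma pow {f : ℝ → ℝ} (hf : IsCosSum f) (N : ℕ) : IsCosSum fun s => f s ^ N := by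
  induction N with
  | zero => simpa using const zero_le_one
  | succ N ih => simpa only [pow_succ] using ih.mul hf

/-- Since the Fejér kernel is nonnegative, averages of a positive definite function against
triangular weights are largest when the weight is centred at the origin. -/
lemma integral_triangle_translate_le {f : ℝ → ℝ} (hf : IsCosSum f) {T : ℝ} (hT : 0 < T) (x : ℝ) :
    ∫ s in (-T)..T, (1 - |s| / T) * f (x + s) ≤ ∫ s in (-T)..T, (1 - |s| / T) * f s := by
  induction hf with
  | cos b =>
    have h : ∀ s, (1 - |s| / T) * Real.cos ((x + s) * b)
        = Real.cos (x * b) * ((1 - |s| / T) * Real.cos (s * b))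
          - Real.sin (x * b) * ((1 - |s| / T) * Real.sin (s * b)) := fun s => by
      rw [add_mul, Real.cos_add]; ring
    simp only [h]
    rw [intervalIntegral.integral_sub (by apply Continuous.intervalIntegrable; fun_prop)
      (by apply Continuous.intervalIntegrable; fun_prop), intervalIntegral.integral_const_mul,
      intervalIntegral.integral_const_mul,
      integral_neg_self_eq_zero (f := fun s => (1 - |s| / T) * Real.sin (s * b)) (by simp),
      mul_zero, sub_zero]
    exact mul_le_of_le_one_left (fejer_nonneg hT b) (Real.cos_le_one _)
  | @smul f c hc _ ih =>
    simp only [mul_left_comm _ c, intervalIntegral.integral_const_mul]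
    exact mul_le_mul_of_nonneg_left ih hc
  | @add f g hf hg ih1 ih2 =>
    have hfc := hf.continuous
    have hgc := hg.continuous
    simp only [mul_add]
    rw [intervalIntegral.integral_add (by apply Continuous.intervalIntegrable; fun_prop)
      (by apply Continuous.intervalIntegrable; fun_prop),
      intervalIntegral.integral_add (by apply Continuous.intervalIntegrable; fun_prop)
      (by apply Continuous.intervalIntegrable; fun_prop)]
    exact add_le_add ih1 ih2

/-- The comparison passes from cosine polynomials to their exponentials, as
`(1 + f / N) ^ N → exp f`. -/
lemma integral_triangle_exp_translate_le {f : ℝ → ℝ} (hf : IsCosSum f) {T : ℝ} (hT : 0 < T)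
    (x : ℝ) : ∫ s in (-T)..T, (1 - |s| / T) * Real.exp (f (x + s))
      ≤ ∫ s in (-T)..T, (1 - |s| / T) * Real.exp (f s) := by
  have hfc := hf.continuous
  have key : ∀ y, Tendsto (fun N : ℕ => ∫ s in (-T)..T, (1 - |s| / T) * (1 + f (y + s) / N) ^ N)
      atTop (𝓝 (∫ s in (-T)..T, (1 - |s| / T) * Real.exp (f (y + s)))) := by
    intro y
    refine intervalIntegral.tendsto_integral_filter_of_dominated_convergence
      (fun s => Real.exp |f (y + s)|) (Eventually.of_forall fun N => ?_)
      (Eventually.of_forall fun N => ae_of_all _ fun s hs => ?_)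
      (by apply Continuous.intervalIntegrable; fun_prop) (ae_of_all _ fun s _ => ?_)
    · exact Continuous.aestronglyMeasurable (by fun_prop)
    · rw [Set.uIoc_of_le (by linarith)] at hs
      rw [norm_mul]
      have h1 := abs_triangle_le_one hT (Set.Ioc_subset_Icc_self hs)
      refine (mul_le_of_le_one_left (norm_nonneg _) h1).trans ?_
      rw [norm_pow]
      have h2 : ‖1 + f (y + s) / N‖ ≤ Real.exp (|f (y + s)| / N) := by
        refine (norm_add_le _ _).trans ?_
        rw [norm_one, norm_div, Real.norm_natCast, Real.norm_eq_abs, add_comm]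
        exact Real.add_one_le_exp _
      refine (pow_le_pow_left₀ (norm_nonneg _) h2 N).trans ?_
      rw [← Real.exp_nat_mul]
      rcases Nat.eq_zero_or_pos N with rfl | hN
      · simp
      · rw [mul_div_cancel₀ _ (by positivity)]
    · exact (Real.tendsto_one_add_div_pow_exp _).const_mul _
  have key0 := key 0
  simp only [zero_add] at key0
  refine le_of_tendsto_of_tendsto' (key x) key0 fun N => ?_
  have hN : IsCosSum fun s => (1 + f s / N) ^ N := by
    have := ((const zero_le_one).add (hf.smul (c := 1 / N) (by positivity))).pow N
    convert this using 4
    ring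
  exact hN.integral_triangle_translate_le hT x

lemma integral_exp_window_le {f : ℝ → ℝ} (hf : IsCosSum f) {T : ℝ} (hT : 0 < T) (x : ℝ) :
    ∫ s in x..(x + T), Real.exp (f s) ≤ 2 * ∫ s in (-T)..T, Real.exp (f s) := by
  have hfc := hf.continuous
  have h1 : ∫ s in (-T)..T, (1 - |s| / T) * Real.exp (f s) ≤ ∫ s in (-T)..T, Real.exp (f s) := by
    refine intervalIntegral.integral_mono_on (by linarith)
      (by apply Continuous.intervalIntegrable; fun_prop)
      (by apply Continuous.intervalIntegrable; fun_prop) fun s _ =>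
        mul_le_of_le_one_left (Real.exp_nonneg _) (triangle_le_one hT s)
  have h2 := hf.integral_triangle_exp_translate_le hT (x + T / 2)
  have h3 : ∫ s in (-(T / 2))..(T / 2), (1 / 2) * Real.exp (f (x + T / 2 + s))
      ≤ ∫ s in (-T)..T, (1 - |s| / T) * Real.exp (f (x + T / 2 + s)) := by
    have h4 : ∫ s in (-(T / 2))..(T / 2), (1 / 2) * Real.exp (f (x + T / 2 + s))
        ≤ ∫ s in (-(T / 2))..(T / 2), (1 - |s| / T) * Real.exp (f (x + T / 2 + s)) := by
      refine intervalIntegral.integral_mono_on (by linarith)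
        (by apply Continuous.intervalIntegrable; fun_prop)
        (by apply Continuous.intervalIntegrable; fun_prop) fun s hs => ?_
      refine mul_le_mul_of_nonneg_right ?_ (Real.exp_nonneg _)
      have : |s| / T ≤ 1 / 2 := by
        rw [div_le_iff₀ hT]
        linarith [abs_le.2 hs]
      linarith
    refine h4.trans (intervalIntegral.integral_mono_interval (by linarith) (by linarith)
      (by linarith) ?_ (by apply Continuous.intervalIntegrable; fun_prop))
    refine (ae_restrict_mem measurableSet_Ioc).mono fun s hs => ?_
    exact mul_nonneg (triangle_nonneg (Set.Ioc_subset_Icc_self hs)) (Real.exp_nonneg _)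
  rw [intervalIntegral.integral_const_mul,
    intervalIntegral.integral_comp_add_left (fun s => Real.exp (f s))] at h3
  have e1 : x + T / 2 + -(T / 2) = x := by ring
  have e2 : x + T / 2 + T / 2 = x + T := by ring
  rw [e1, e2] at h3
  linarith

/-- The integral of `exp f` over `[0, z T]` is covered by `⌈z⌉ ≤ 2 z` windows of length `T`. -/
lemma integral_exp_mul_le {f : ℝ → ℝ} (hf : IsCosSum f) {T z : ℝ} (hT : 0 < T) (hz : 1 ≤ z) :
    ∫ s in (0 : ℝ)..(T * z), Real.exp (f s) ≤ 4 * z * ∫ s in (-T)..T, Real.exp (f s) := by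
  have hfc := hf.continuous
  have hI : ∀ a b, IntervalIntegrable (fun s => Real.exp (f s)) volume a b :=
    fun a b => Continuous.intervalIntegrable (by fun_prop) a b
  set A := ∫ s in (-T)..T, Real.exp (f s)
  have hA : 0 ≤ A := intervalIntegral.integral_nonneg (by linarith) fun _ _ => Real.exp_nonneg _
  have h1 : ∫ s in (0 : ℝ)..(T * z), Real.exp (f s)
      ≤ ∫ s in (0 : ℝ)..(⌈z⌉₊ * T), Real.exp (f s) := by
    refine intervalIntegral.integral_mono_interval le_rfl (by positivity) ?_
      (ae_of_all _ fun _ => Real.exp_nonneg _) (hI _ _)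
    rw [mul_comm]
    exact mul_le_mul_of_nonneg_right (Nat.le_ceil z) hT.le
  have h2 := intervalIntegral.sum_integral_adjacent_intervals (a := fun k : ℕ => k * T)
    (n := ⌈z⌉₊) (fun k _ => hI (k * T) ((k + 1 : ℕ) * T))
  simp only [Nat.cast_zero, zero_mul] at h2
  rw [← h2] at h1
  refine h1.trans ((Finset.sum_le_card_nsmul _ _ (2 * A) fun k _ => ?_).trans ?_)
  · have := hf.integral_exp_window_le hT (k * T)
    rwa [show (k * T + T : ℝ) = (k + 1 : ℕ) * T by push_cast; ring] at this
  · rw [Finset.card_range, nsmul_eq_mul]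
    have : (⌈z⌉₊ : ℝ) ≤ 2 * z := by
      have := Nat.ceil_lt_add_one (zero_le_one.trans hz)
      linarith
    nlinarith

end IsCosSum

/-! ### The characteristic function of a weighted sum -/

/-- The function `ψ_a(s) = ∑ₖ (1 - cos (s aₖ))`. The compound Poisson law with characteristic
function `exp (-p ψ_a)` is what weighted sums are compared with. -/
noncomputable def cosDefect {n : ℕ} (a : EuclideanSpace ℝ (Fin n)) (s : ℝ) : ℝ :=
  ∑ k, (1 - Real.cos (s * a k))

section cosDefect

variable {n : ℕ} (a : EuclideanSpace ℝ (Fin n))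

@[fun_prop]
lemma continuous_cosDefect : Continuous (cosDefect a) := by
  unfold cosDefect
  fun_prop

lemma cosDefect_nonneg (s : ℝ) : 0 ≤ cosDefect a s :=
  Finset.sum_nonneg fun _ _ => sub_nonneg.2 (Real.cos_le_one _)

lemma cosDefect_le (s : ℝ) : cosDefect a s ≤ 2 * n := by
  refine (Finset.sum_le_card_nsmul _ _ 2 fun k _ => ?_).trans ?_
  · linarith [Real.neg_one_le_cos (s * a k)]
  · simp [mul_comm]

@[simp]
lemma cosDefect_neg (s : ℝ) : cosDefect a (-s) = cosDefect a s := by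
  simp [cosDefect]

@[simp]
lemma cosDefect_zero : cosDefect a 0 = 0 := by
  simp [cosDefect]

lemma cosDefect_mul_abs (t z : ℝ) : cosDefect a (t * |z|) = cosDefect a (t * z) := by
  rcases abs_choice z with h | h <;> simp [h]

end cosDefect

instance isProbabilityMeasure_symmetrization (μ : Measure ℝ) [IsProbabilityMeasure μ] :
    IsProbabilityMeasure (symmetrization μ) :=
  Measure.isProbabilityMeasure_map (by fun_prop)

lemma integral_cos_symmetrization (μ : Measure ℝ) [IsProbabilityMeasure μ] (t : ℝ) :
    ∫ z, Real.cos (t * z) ∂(symmetrization μ) = ‖charFun μ t‖ ^ 2 := by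
  have h1 : charFun (symmetrization μ) t = charFun μ t * charFun μ (-t) := by
    rw [symmetrization, charFun_apply_real, integral_map (by fun_prop) (by fun_prop),
      charFun_apply_real, charFun_apply_real, ← integral_prod_mul]
    refine integral_congr_ae (ae_of_all _ fun p => ?_)
    simp only [← Complex.exp_add]
    push_cast
    ring_nf
  rw [charFun_neg, Complex.mul_conj, Complex.normSq_eq_norm_sq] at h1
  have hint : Integrable (fun x : ℝ => Complex.exp (t * x * Complex.I)) (symmetrization μ) := by
    refine Integrable.mono' (integrable_const 1) (by fun_prop) (ae_of_all _ fun x => ?_)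
    rw [← Complex.ofReal_mul, Complex.norm_exp_ofReal_mul_I]
  have h2 := integral_re hint
  simp only [RCLike.re_to_complex] at h2
  rw [← charFun_apply_real, h1, Complex.ofReal_re] at h2
  rw [← h2]
  refine integral_congr_ae (ae_of_all _ fun x => ?_)
  simp only [← Complex.ofReal_mul, Complex.exp_ofReal_mul_I_re]

lemma integrable_cos_mul (μ : Measure ℝ) [IsFiniteMeasure μ] (t : ℝ) :
    Integrable (fun z => Real.cos (t * z)) μ :=
  Integrable.mono' (integrable_const 1) (by fun_prop)
    (ae_of_all _ fun _ => Real.abs_cos_le_one _)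

lemma norm_charFun_le_exp (μ : Measure ℝ) [IsProbabilityMeasure μ] (t : ℝ) :
    ‖charFun μ t‖ ≤ Real.exp (-(1 / 2 * ∫ z, (1 - Real.cos (t * z)) ∂(symmetrization μ))) := by
  rw [integral_sub (integrable_const 1) (integrable_cos_mul _ t), integral_cos_symmetrization]
  refine le_of_sq_le_sq ?_ (Real.exp_nonneg _)
  rw [← Real.exp_nat_mul]
  have := Real.add_one_le_exp (‖charFun μ t‖ ^ 2 - 1)
  simp only [integral_const, probReal_univ, smul_eq_mul, mul_one]
  refine le_trans (by linarith) (this.trans_eq ?_)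
  congr 1
  push_cast
  ring

lemma norm_charFun_sum_le {Ω : Type*} [MeasurableSpace Ω] {P : Measure Ω} [IsProbabilityMeasure P]
    {n : ℕ} {X : Ω → ℝ} {Xs : Fin n → Ω → ℝ} (hind : iIndepFun Xs P) (hX : AEMeasurable X P)
    (hid : ∀ k, IdentDistrib (Xs k) X P P) (a : EuclideanSpace ℝ (Fin n)) (t : ℝ) :
    ‖charFun (P.map fun ω => ∑ k, a k * Xs k ω) t‖
      ≤ Real.exp (-(1 / 2 * ∫ z, cosDefect a (t * z) ∂(symmetrization (P.map X)))) := by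
  have : IsProbabilityMeasure (P.map X) := Measure.isProbabilityMeasure_map hX
  have hmeas : ∀ k, AEMeasurable (Xs k) P := fun k => (hid k).aemeasurable_fst
  have hind' : iIndepFun (fun k ω => a k * Xs k ω) P :=
    hind.comp (fun k x => a k * x) fun k => measurable_const_mul (a k)
  have hprod : charFun (P.map fun ω => ∑ k, a k * Xs k ω) t
      = ∏ k, charFun (P.map X) (a k * t) := by
    rw [iIndepFun.charFun_map_fun_sum_eq_prod (fun k => (hmeas k).const_mul (a k)) hind',
      Finset.prod_apply]
    refine Finset.prod_congr rfl fun k _ => ?_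
    rw [charFun_map_mul_comp (hmeas k), (hid k).map_eq]
  rw [hprod, norm_prod]
  refine (Finset.prod_le_prod (fun _ _ => norm_nonneg _)
    fun k _ => norm_charFun_le_exp (P.map X) (a k * t)).trans_eq ?_
  rw [← Real.exp_sum, Finset.sum_neg_distrib, ← Finset.mul_sum]
  simp only [cosDefect]
  rw [integral_finsetSum]
  · simp only [mul_assoc, mul_comm, mul_left_comm]
  · intro k _
    refine (integrable_const 1).sub ?_
    simpa only [mul_assoc, mul_comm, mul_left_comm] using integrable_cos_mul _ (a k * t)

/-! ### Pointwise bounds from the distance to the integer lattice -/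

lemma eight_mul_sub_round_sq_le (x : ℝ) :
    8 * (x - round x) ^ 2 ≤ 1 - Real.cos (2 * Real.pi * x) := by
  have h1 : Real.cos (2 * Real.pi * x) = Real.cos (2 * Real.pi * (x - round x)) := by
    rw [← Real.cos_sub_int_mul_two_pi (2 * Real.pi * x) (round x)]
    ring_nf
  have h2 : |2 * Real.pi * (x - round x)| ≤ Real.pi := by
    rw [abs_mul, abs_of_pos Real.two_pi_pos]
    nlinarith [abs_sub_round x, Real.pi_pos]
  have h3 := Real.cos_le_one_sub_mul_cos_sq h2
  have h4 : 2 / Real.pi ^ 2 * (2 * Real.pi * (x - round x)) ^ 2 = 8 * (x - round x) ^ 2 := by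
    field_simp
    ring
  rw [h1]
  linarith

section Lattice

variable {n : ℕ} {a : EuclideanSpace ℝ (Fin n)} {L D : ℝ}

lemma eight_mul_norm_sub_intVec_sq_le (a : EuclideanSpace ℝ (Fin n)) (u : ℝ) :
    8 * ‖u • a - intVec fun k => round (u * a k)‖ ^ 2 ≤ cosDefect a (2 * Real.pi * u) := by
  rw [EuclideanSpace.norm_sq_eq, Finset.mul_sum]
  refine Finset.sum_le_sum fun k _ => ?_
  have h := eight_mul_sub_round_sq_le (u * a k)
  simpa [intVec, mul_assoc] using h

lemma fL_nonneg (hL : 0 < L) {t : ℝ} (ht : 0 < t) : 0 ≤ fL L t := by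
  unfold fL
  split_ifs <;> positivity

lemma fL_le_self (hL : 0 < L) {t : ℝ} (ht : 0 < t) : fL L t ≤ t := by
  unfold fL
  split_ifs
  · linarith
  · have hv : 0 < t / L := div_pos ht hL
    have h : Real.sqrt (Real.log (t / L)) ≤ t / L := by
      refine Real.sqrt_le_iff.2 ⟨hv.le, ?_⟩
      nlinarith [Real.log_le_sub_one_of_pos hv, sq_nonneg (t / L - 1)]
    calc L * Real.sqrt (Real.log (t / L)) ≤ L * (t / L) := mul_le_mul_of_nonneg_left h hL.le
      _ = t := by field_simp

/-- The lattice condition extends to all `t ∈ (0, D]`: for `t < 1 / (2 ‖a‖_∞)` the lattice point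
nearest to `t a` is the origin, and `‖t a‖ = t ≥ f_L(t)`. -/
lemma fL_le_norm_sub_round (ha : ‖a‖ = 1) (hL : 0 < L)
    (hlat : ∀ m : Fin n → ℤ, ∀ t ∈ Set.Icc (1 / (2 * supNorm a)) D,
      ‖t • a - intVec m‖ ≥ fL L t) {u : ℝ} (hu : 0 < u) (huD : u ≤ D) :
    fL L u ≤ ‖u • a - intVec fun k => round (u * a k)‖ := by
  rcases le_or_gt (1 / (2 * supNorm a)) u with h | h
  · exact hlat _ u ⟨h, huD⟩
  · have hs : 0 < supNorm a := by
      by_contra hs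
      have : 1 / (2 * supNorm a) ≤ 0 := one_div_nonpos.2 (by linarith)
      linarith
    have hr : (intVec fun k => round (u * a k)) = 0 := by
      ext k
      have hk : |u * a k| < 1 / 2 := by
        rw [abs_mul, abs_of_pos hu]
        have h1 : |a k| ≤ supNorm a := norm_le_pi_norm (WithLp.ofLp a) k
        rw [lt_div_iff₀ (by positivity)] at h
        nlinarith
      have : round (u * a k) = 0 := by
        rw [abs_lt] at hk
        rw [round_eq_zero_iff]
        constructor <;> linarith
      simp [intVec, this]
    rw [hr, sub_zero, norm_smul, ha, mul_one, Real.norm_of_nonneg hu.le]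
    exact fL_le_self hL hu

lemma fL_sq_le_cosDefect (ha : ‖a‖ = 1) (hL : 0 < L)
    (hlat : ∀ m : Fin n → ℤ, ∀ t ∈ Set.Icc (1 / (2 * supNorm a)) D,
      ‖t • a - intVec m‖ ≥ fL L t) {u : ℝ} (hu : 0 < u) (huD : u ≤ D) :
    8 * fL L u ^ 2 ≤ cosDefect a (2 * Real.pi * u) := by
  refine le_trans ?_ (eight_mul_norm_sub_intVec_sq_le a u)
  have := fL_le_norm_sub_round ha hL hlat hu huD
  have h0 := fL_nonneg hL hu
  gcongr

/-- In the range `v ≥ e` the power `v ^ (-q)` is dominated by `(q v ^ 2)⁻¹` uniformly in `q ≥ 4`,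
because `log q ≤ q - 2`. -/
lemma exp_neg_mul_log_le {q v : ℝ} (hq : 4 ≤ q) (hv : 0 < v) (hlog : 1 ≤ Real.log v) :
    Real.exp (-(q * Real.log v)) ≤ 36 / (1 + q * v ^ 2) := by
  have hlogq : Real.log q ≤ q - 2 := by
    have h1 := Real.log_le_sub_one_of_pos (show 0 < q / 4 by linarith)
    have h2 : Real.log q = Real.log (q / 4) + 2 * Real.log 2 := by
      rw [Real.log_div (by linarith) (by norm_num), show (4 : ℝ) = 2 ^ 2 by norm_num, Real.log_pow]
      push_cast
      ring
    linarith [Real.log_two_lt_d9]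
  have h1 : q * v ^ 2 ≤ Real.exp (q * Real.log v) := by
    rw [← Real.exp_log (show 0 < q * v ^ 2 by positivity), Real.exp_le_exp,
      Real.log_mul (by linarith) (by positivity), Real.log_pow]
    push_cast
    nlinarith
  have h2 : 1 ≤ Real.exp (q * Real.log v) := Real.one_le_exp (by nlinarith)
  rw [Real.exp_neg, inv_eq_one_div, div_le_div_iff₀ (Real.exp_pos _) (by positivity)]
  linarith

/-- The pointwise bound, in terms of `y = √M t / π`. Below `e L` it follows from
`exp (-y ^ 2 / 36) ≤ 36 / (36 + y ^ 2)`. Beyond `e L`, the exponential is the power `v ^ (-q)` with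
`v = t z / (2 π L)`, `q = 4 M L ^ 2 / z ^ 2` and `q v ^ 2 = y ^ 2`. -/
lemma exp_neg_cosDefect_le (ha : ‖a‖ = 1) (hL : 0 < L)
    (hlat : ∀ m : Fin n → ℤ, ∀ t ∈ Set.Icc (1 / (2 * supNorm a)) D,
      ‖t • a - intVec m‖ ≥ fL L t) {M : ℝ} (hM : 0 < M) (hLM : 1 ≤ M * L ^ 2)
    {z : ℝ} (hz : 0 < z) (hz1 : z ≤ 1) {t : ℝ} (ht : 0 ≤ t) (htD : t ≤ D) :
    Real.exp (-(M / (2 * z ^ 2) * cosDefect a (t * z)))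
      ≤ 36 * (1 + (Real.sqrt M / Real.pi * t) ^ 2)⁻¹ := by
  rcases ht.eq_or_lt with rfl | ht
  · norm_num
  have hpi := Real.pi_gt_three
  set u := t * z / (2 * Real.pi) with hu
  have hu0 : 0 < u := by positivity
  have huD : u ≤ D := by
    refine le_trans ?_ htD
    rw [hu, div_le_iff₀ (by positivity)]
    nlinarith
  have htz : t * z = 2 * Real.pi * u := by rw [hu]; field_simp
  have hbound : M / (2 * z ^ 2) * (8 * fL L u ^ 2)
      ≤ M / (2 * z ^ 2) * cosDefect a (t * z) := by
    rw [htz]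
    exact mul_le_mul_of_nonneg_left (fL_sq_le_cosDefect ha hL hlat hu0 huD) (by positivity)
  refine (Real.exp_le_exp.2 (neg_le_neg hbound)).trans ?_
  rw [mul_pow, div_pow, Real.sq_sqrt hM.le]
  unfold fL
  split_ifs with h
  · have e : M / (2 * z ^ 2) * (8 * (u / 6) ^ 2) = M / Real.pi ^ 2 * t ^ 2 / 36 := by
      rw [hu]; field_simp; ring
    rw [e, Real.exp_neg]
    set Y := M / Real.pi ^ 2 * t ^ 2 with hY
    have hY0 : 0 ≤ Y := by positivity
    have := Real.add_one_le_exp (Y / 36)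
    rw [← div_eq_mul_inv, inv_eq_one_div, div_le_div_iff₀ (Real.exp_pos _) (by positivity)]
    linarith
  · have hlog : 1 ≤ Real.log (u / L) := by
      rw [Real.le_log_iff_exp_le (by positivity), le_div_iff₀ hL]
      exact not_lt.1 h
    have e : M / (2 * z ^ 2) * (8 * (L * Real.sqrt (Real.log (u / L))) ^ 2)
        = 4 * M * L ^ 2 / z ^ 2 * Real.log (u / L) := by
      rw [mul_pow, Real.sq_sqrt (by linarith)]
      field_simp
      ring
    have e2 : M / Real.pi ^ 2 * t ^ 2 = 4 * M * L ^ 2 / z ^ 2 * (u / L) ^ 2 := by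
      rw [hu]; field_simp; ring
    rw [e, e2, ← div_eq_mul_inv]
    refine exp_neg_mul_log_le ?_ (by positivity) hlog
    rw [le_div_iff₀ (by positivity)]
    nlinarith

/-! ### Integral bounds -/

lemma integral_exp_neg_cosDefect_le_of_le_one (ha : ‖a‖ = 1) (hL : 0 < L) (hD : 0 < D)
    (hlat : ∀ m : Fin n → ℤ, ∀ t ∈ Set.Icc (1 / (2 * supNorm a)) D,
      ‖t • a - intVec m‖ ≥ fL L t) {M : ℝ} (hM : 0 < M) (hLM : 1 ≤ M * L ^ 2)
    {z : ℝ} (hz : 0 < z) (hz1 : z ≤ 1) :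
    ∫ t in (-D)..D, Real.exp (-(M / (2 * z ^ 2) * cosDefect a (t * z)))
      ≤ 36 * Real.pi ^ 2 / Real.sqrt M := by
  rw [integral_neg_self_eq_two_mul (by fun_prop) (by simp)]
  have hsM : 0 < Real.sqrt M := Real.sqrt_pos.2 hM
  have hpi := Real.pi_pos
  have hcont : Continuous fun t : ℝ => 36 * (1 + (Real.sqrt M / Real.pi * t) ^ 2)⁻¹ := by
    refine continuous_const.mul (Continuous.inv₀ (by fun_prop) fun t => ?_)
    positivity
  have h1 : ∫ t in (0 : ℝ)..D, Real.exp (-(M / (2 * z ^ 2) * cosDefect a (t * z)))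
      ≤ ∫ t in (0 : ℝ)..D, 36 * (1 + (Real.sqrt M / Real.pi * t) ^ 2)⁻¹ :=
    intervalIntegral.integral_mono_on hD.le (by apply Continuous.intervalIntegrable; fun_prop)
      (hcont.intervalIntegrable _ _)
      fun t ht => exp_neg_cosDefect_le ha hL hlat hM hLM hz hz1 ht.1 ht.2
  rw [intervalIntegral.integral_const_mul,
    intervalIntegral.integral_comp_mul_left (fun x => (1 + x ^ 2)⁻¹) (by positivity),
    integral_inv_one_add_sq, mul_zero, Real.arctan_zero, sub_zero, smul_eq_mul, inv_div] at h1
  have h2 := (Real.arctan_lt_pi_div_two (Real.sqrt M / Real.pi * D)).le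
  have h3 : Real.pi / Real.sqrt M * Real.arctan (Real.sqrt M / Real.pi * D)
      ≤ Real.pi / Real.sqrt M * (Real.pi / 2) := mul_le_mul_of_nonneg_left h2 (by positivity)
  calc _ ≤ 2 * (36 * (Real.pi / Real.sqrt M * (Real.pi / 2))) := by linarith
    _ = _ := by ring

/-- For `z ≥ 1` the scaled integral over `[-D, D]` runs over `[-D z, D z]`, where the lattice
condition says nothing. It is controlled by the integral over `[-D, D]` because `exp (-p ψ_a)` is
positive definite. -/
lemma integral_exp_neg_cosDefect_mul_le (a : EuclideanSpace ℝ (Fin n)) (hD : 0 < D) {p : ℝ}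
    (hp : 0 ≤ p) {z : ℝ} (hz : 1 ≤ z) :
    ∫ t in (-D)..D, Real.exp (-(p * cosDefect a (t * z)))
      ≤ 8 * ∫ s in (-D)..D, Real.exp (-(p * cosDefect a s)) := by
  rw [integral_neg_self_eq_two_mul (by fun_prop) (by simp)]
  have hz0 : 0 < z := by linarith
  rw [intervalIntegral.integral_comp_mul_right (fun s => Real.exp (-(p * cosDefect a s))) hz0.ne',
    zero_mul, smul_eq_mul]
  have hcone : IsCosSum fun s => p * ∑ k, Real.cos (s * a k) :=
    (IsCosSum.sum _ fun k _ => IsCosSum.cos (a k)).smul hp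
  have h := hcone.integral_exp_mul_le hD hz
  have e : ∀ s, Real.exp (-(p * cosDefect a s))
      = Real.exp (-(p * n)) * Real.exp (p * ∑ k, Real.cos (s * a k)) := fun s => by
    rw [← Real.exp_add, cosDefect, Finset.sum_sub_distrib]
    simp
    ring
  simp only [e, intervalIntegral.integral_const_mul]
  have h2 := mul_le_mul_of_nonneg_left h
    (show 0 ≤ 2 * (z⁻¹ * Real.exp (-(p * n))) by positivity)
  refine le_of_eq_of_le (by ring) (h2.trans_eq ?_)
  field_simp
  ring

lemma integral_exp_neg_cosDefect_le (ha : ‖a‖ = 1) (hL : 0 < L) (hD : 0 < D)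
    (hlat : ∀ m : Fin n → ℤ, ∀ t ∈ Set.Icc (1 / (2 * supNorm a)) D,
      ‖t • a - intVec m‖ ≥ fL L t) {M : ℝ} (hM : 0 < M) (hLM : 1 ≤ M * L ^ 2)
    {z : ℝ} (hz : z ≠ 0) :
    ∫ t in (-D)..D, Real.exp (-(M / (2 * min (z ^ 2) 1) * cosDefect a (t * z)))
      ≤ 288 * Real.pi ^ 2 / Real.sqrt M := by
  have hsM : 0 < Real.sqrt M := Real.sqrt_pos.2 hM
  have hz0 : 0 < |z| := abs_pos.2 hz
  simp only [← cosDefect_mul_abs a _ z, ← sq_abs z]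
  rcases le_total |z| 1 with h | h
  · rw [min_eq_left (pow_le_one₀ hz0.le h)]
    refine (integral_exp_neg_cosDefect_le_of_le_one ha hL hD hlat hM hLM hz0 h).trans ?_
    gcongr
    norm_num
  · rw [min_eq_right (one_le_pow₀ h)]
    refine (integral_exp_neg_cosDefect_mul_le a hD (by positivity) h).trans ?_
    have := integral_exp_neg_cosDefect_le_of_le_one ha hL hD hlat hM hLM one_pos le_rfl
    simp only [one_pow, mul_one] at this ⊢
    calc _ ≤ 8 * (36 * Real.pi ^ 2 / Real.sqrt M) := by linarith
      _ = _ := by ring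

end Lattice

/-- Jensen's inequality for the exponential and a probability density `w`. -/
lemma exp_neg_integral_mul_le {α : Type*} [MeasurableSpace α] {μ : Measure α} {p w : α → ℝ}
    (hw : ∀ x, 0 ≤ w x) (hw1 : ∫ x, w x ∂μ = 1) (hwi : Integrable w μ)
    (hpw : Integrable (fun x => p x * w x) μ)
    (hew : Integrable (fun x => Real.exp (-p x) * w x) μ) :
    Real.exp (-∫ x, p x * w x ∂μ) ≤ ∫ x, Real.exp (-p x) * w x ∂μ := by
  set A := ∫ x, p x * w x ∂μ with hA
  -- Integrate the tangent line inequality `exp (-p) ≥ exp (-A) * (1 + A - p)` against `w`.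
  have h1 : ∫ x, Real.exp (-A) * ((1 + A) * w x - p x * w x) ∂μ
      ≤ ∫ x, Real.exp (-p x) * w x ∂μ := by
    refine integral_mono (((hwi.const_mul _).sub hpw).const_mul _) hew fun x => ?_
    have h : Real.exp (-A) * (1 + A - p x) ≤ Real.exp (-p x) := by
      have := mul_le_mul_of_nonneg_left (Real.add_one_le_exp (A - p x)) (Real.exp_nonneg (-A))
      rw [← Real.exp_add] at this
      rw [show -A + (A - p x) = -p x by ring] at this
      linarith
    calc _ = Real.exp (-A) * (1 + A - p x) * w x := by ring
      _ ≤ _ := mul_le_mul_of_nonneg_right h (hw x)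
  rw [integral_const_mul, integral_sub (hwi.const_mul _) hpw, integral_const_mul, hw1, ← hA] at h1
  simpa using h1

/-- Splitting off the weight `min (z ^ 2) 1`, whose integral is `M`, Jensen's inequality and
Fubini's theorem reduce to a bound that is uniform in `z`. -/
lemma integral_exp_neg_integral_cosDefect_le {n : ℕ} {a : EuclideanSpace ℝ (Fin n)} {D M C : ℝ}
    (G : Measure ℝ) [IsProbabilityMeasure G] (hD : 0 < D) (hM : 0 < M)
    (hMG : ∫ z, min (z ^ 2) 1 ∂G = M)
    (hC : ∀ z : ℝ, z ≠ 0 →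
      ∫ t in (-D)..D, Real.exp (-(M / (2 * min (z ^ 2) 1) * cosDefect a (t * z))) ≤ C)
    {φ : ℝ → ℝ} (hφc : Continuous φ)
    (hφ : ∀ t, φ t ≤ Real.exp (-(1 / 2 * ∫ z, cosDefect a (t * z) ∂G))) :
    ∫ t in (-D)..D, φ t ≤ C := by
  have hDD : -D ≤ D := by linarith
  set w : ℝ → ℝ := fun z => min (z ^ 2) 1 / M with hw
  set p : ℝ → ℝ → ℝ := fun t z => M / (2 * min (z ^ 2) 1) * cosDefect a (t * z) with hp
  have hm0 : ∀ z : ℝ, 0 ≤ min (z ^ 2) 1 := fun z => le_min (sq_nonneg z) zero_le_one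
  have hw0 : ∀ z, 0 ≤ w z := fun z => div_nonneg (hm0 z) hM.le
  have hwM : ∀ z, w z ≤ 1 / M := fun z => div_le_div_of_nonneg_right (min_le_right _ _) hM.le
  have hwm : Measurable w := by fun_prop
  have hwi : Integrable w G :=
    Integrable.mono' (integrable_const (1 / M)) hwm.aestronglyMeasurable
      (ae_of_all _ fun z => by rw [Real.norm_of_nonneg (hw0 z)]; exact hwM z)
  have hw1 : ∫ z, w z ∂G = 1 := by
    rw [hw, integral_div, hMG, div_self hM.ne']
  have hp0 : ∀ t z, 0 ≤ p t z := fun t z =>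
    mul_nonneg (div_nonneg hM.le (mul_nonneg zero_le_two (hm0 z))) (cosDefect_nonneg a _)
  have hpw : ∀ t z, p t z * w z = 1 / 2 * cosDefect a (t * z) := fun t z => by
    rcases eq_or_ne z 0 with rfl | hz
    · simp [hp]
    · have : 0 < min (z ^ 2) 1 := lt_min (by positivity) one_pos
      simp only [hp, hw]
      field_simp
  have hcd : Measurable (cosDefect a) := (continuous_cosDefect a).measurable
  have hem : Measurable (Function.uncurry fun t z => Real.exp (-p t z) * w z) := by
    simp only [Function.uncurry_def, hp, hw]
    fun_prop
  have heb : ∀ t z, |Real.exp (-p t z) * w z| ≤ 1 / M := fun t z => by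
    rw [abs_of_nonneg (mul_nonneg (Real.exp_nonneg _) (hw0 z))]
    exact (mul_le_of_le_one_left (hw0 z)
      (Real.exp_le_one_iff.2 (neg_nonpos.2 (hp0 t z)))).trans (hwM z)
  have hez : ∀ t, Measurable fun z => Real.exp (-p t z) * w z := fun t =>
    hem.of_uncurry_left
  have hjensen : ∀ t, φ t ≤ ∫ z, Real.exp (-p t z) * w z ∂G := fun t => by
    refine (hφ t).trans ?_
    have hb : Integrable (fun z => p t z * w z) G := by
      simp only [hpw]
      have hm : AEStronglyMeasurable (fun z => cosDefect a (t * z)) G :=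
        (hcd.comp (measurable_const_mul t)).aestronglyMeasurable
      have hbd : ∀ z, ‖cosDefect a (t * z)‖ ≤ 2 * n := fun z => by
        rw [Real.norm_of_nonneg (cosDefect_nonneg a _)]
        exact cosDefect_le a _
      exact (Integrable.mono' (integrable_const _) hm (ae_of_all _ hbd)).const_mul _
    have := exp_neg_integral_mul_le hw0 hw1 hwi hb
      (Integrable.mono' (integrable_const (1 / M)) (hez t).aestronglyMeasurable
        (ae_of_all _ fun z => heb t z))
    simpa only [hpw, integral_const_mul] using this
  have hcont : Continuous fun t => ∫ z, Real.exp (-p t z) * w z ∂G := by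
    have hct : ∀ z, Continuous fun t => Real.exp (-p t z) * w z := fun z => by
      simp only [hp]
      fun_prop
    exact continuous_of_dominated (bound := fun _ => 1 / M)
      (fun t => (hez t).aestronglyMeasurable) (fun t => ae_of_all _ fun z => heb t z)
      (integrable_const _) (ae_of_all _ hct)
  have h1 : ∫ t in (-D)..D, φ t ≤ ∫ t in (-D)..D, ∫ z, Real.exp (-p t z) * w z ∂G :=
    intervalIntegral.integral_mono_on hDD (hφc.intervalIntegrable _ _)
      (hcont.intervalIntegrable _ _) fun t _ => hjensen t
  rw [intervalIntegral_integral_swap_of_bounded hem hDD fun t _ z => heb t z] at h1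
  refine h1.trans ?_
  have h2 : ∀ z, ∫ t in (-D)..D, Real.exp (-p t z) * w z ≤ C * w z := fun z => by
    rw [intervalIntegral.integral_mul_const]
    rcases eq_or_ne z 0 with rfl | hz
    · simp [hw]
    · exact mul_le_mul_of_nonneg_right (hC z hz) (hw0 z)
  have h0 : ∀ z, 0 ≤ ∫ t in (-D)..D, Real.exp (-p t z) * w z := fun z =>
    intervalIntegral.integral_nonneg hDD fun t _ => mul_nonneg (Real.exp_nonneg _) (hw0 z)
  calc ∫ z, (∫ t in (-D)..D, Real.exp (-p t z) * w z) ∂G ≤ ∫ z, C * w z ∂G :=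
        integral_mono_of_nonneg (ae_of_all _ h0) (hwi.const_mul C) (ae_of_all _ h2)
    _ = C := by rw [integral_const_mul, hw1, mul_one]

end LittlewoodOfford

theorem theorem1 :
    ∃ c : ℝ, 0 < c ∧
      ∀ {Ω : Type*} [MeasurableSpace Ω] (P : Measure Ω) [IsProbabilityMeasure P]
        (n : ℕ) (X : Ω → ℝ) (Xs : Fin n → Ω → ℝ)
        (_ : iIndepFun Xs P) (_ : AEMeasurable X P) (_ : ∀ k, IdentDistrib (Xs k) X P P)
        (a : EuclideanSpace ℝ (Fin n)) (_ : ‖a‖ = 1)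
        (L D : ℝ) (_ : 0 < L) (_ : 0 < D)
        (_ : ∀ m : Fin n → ℤ, ∀ t ∈ Set.Icc (1 / (2 * LittlewoodOfford.supNorm a)) D,
          ‖t • a - LittlewoodOfford.intVec m‖ ≥ LittlewoodOfford.fL L t)
        (_ : 0 < LittlewoodOfford.truncatedMoment (P.map X) 1)
        (_ : L ^ 2 ≥ 1 / LittlewoodOfford.truncatedMoment (P.map X) 1),
        LittlewoodOfford.concentration (P.map (fun ω => ∑ k, a k * Xs k ω)) (1 / D) ≤
          c * (1 / (D * Real.sqrt (LittlewoodOfford.truncatedMoment (P.map X) 1))) := by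
  refine ⟨576 * Real.pi ^ 2, by positivity, ?_⟩
  intro Ω _ P _ n X Xs hind hX hid a ha L D hL hD hlat hM hLM
  have hS : AEMeasurable (fun ω => ∑ k, a k * Xs k ω) P :=
    Finset.aemeasurable_fun_sum _ fun k _ => (hid k).aemeasurable_fst.const_mul (a k)
  have : IsProbabilityMeasure (P.map X) := Measure.isProbabilityMeasure_map hX
  have : IsProbabilityMeasure (P.map fun ω => ∑ k, a k * Xs k ω) :=
    Measure.isProbabilityMeasure_map hS
  set M := LittlewoodOfford.truncatedMoment (P.map X) 1 with hMdef
  have hMG : ∫ z, min (z ^ 2) 1 ∂(LittlewoodOfford.symmetrization (P.map X)) = M := by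
    simp [hMdef, LittlewoodOfford.truncatedMoment]
  have hLM' : 1 ≤ M * L ^ 2 := by
    have h := (div_le_iff₀ hM).1 hLM
    linarith
  have hcont : Continuous fun t => ‖charFun (P.map fun ω => ∑ k, a k * Xs k ω) t‖ :=
    continuous_charFun.norm
  have hint := LittlewoodOfford.integral_exp_neg_integral_cosDefect_le
    (LittlewoodOfford.symmetrization (P.map X)) hD hM hMG
    (fun z hz => LittlewoodOfford.integral_exp_neg_cosDefect_le ha hL hD hlat hM hLM' hz)
    hcont (LittlewoodOfford.norm_charFun_sum_le hind hX hid a)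
  refine ciSup_le fun x => ?_
  refine (LittlewoodOfford.measureReal_Icc_le_integral_charFun _ hD x).trans ?_
  refine (mul_le_mul_of_nonneg_left hint (by positivity)).trans_eq ?_
  have := Real.sqrt_pos.2 hM
  field_simp
  ring
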